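/- Let $\mathcal O=\mathbb C\{x,y\}$. A nonsingular $d$-web of $(\mathbb C^2,0)$ is given by germs $F_1,\dots,F_d\in\mathcal O$ with $F_i(0)=0$ and $dF_i(0)\wedge dF_j(0)\neq 0$ for $1\le i<j\le d$; its leaves are the level curves of the $F_i$. Its rank is the complex dimension of the space of abelian relations $$\Big\{(g_1(F_1),\dots,g_d(F_d))\in\mathcal O^d \;:\; g_1,\dots,g_d\in\mathbb C\{t\},\ \sum_{i=1}^d g_i(F_i)\,dF_i=0\Big\},$$ and the maximal rank of a $d$-web is $\tfrac12(d-1)(d-2)$, that is, $3$ for $d=4$. A $4$-web is called hexagonal if its four extracted $3$-webs (each obtained by omitting one of the $F_i$) all have rank $1$. **Proposition (G. Bol, case $d=4$).** Every hexagonal nonsingular planar $4$-web is of maximal rank, i.e. has rank $3$. -/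

import Mathlib

open Filter Topology

/-- The value at the point `z` of the wedge product `dF ∧ dG`, i.e. its coefficient
`∂ₓF ∂_yG - ∂_yF ∂ₓG` with respect to `dx ∧ dy`. -/
noncomputable def wedgeD (F G : ℂ × ℂ → ℂ) (z : ℂ × ℂ) : ℂ :=
  fderiv ℂ F z (1, 0) * fderiv ℂ G z (0, 1) - fderiv ℂ F z (0, 1) * fderiv ℂ G z (1, 0)

/-- A nonsingular `d`-web of `(ℂ², 0)`: `d` holomorphic germs `F i` vanishing at the origin,
whose level curves are the leaves, in general position at the origin. The germs are given
by representatives; only their values near the origin matter. -/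
structure PlanarWeb (d : ℕ) where
  /-- The functions whose level curves are the leaves. -/
  F : Fin d → ℂ × ℂ → ℂ
  analyticAt : ∀ i, AnalyticAt ℂ (F i) 0
  map_zero : ∀ i, F i 0 = 0
  generalPosition : ∀ i j, i < j → wedgeD (F i) (F j) 0 ≠ 0

namespace PlanarWeb

variable {d : ℕ}

/-- The complex vector space of abelian relations of a web: the tuples
`(g₁(F₁), …, g_d(F_d))` of germs at the origin of `ℂ²`, with each `g i` a holomorphic germ at
the origin of `ℂ`, such that `∑ g i (F i) dF i = 0` as a germ of a `1`-form
(evaluated at points `z` near the origin and on tangent vectors `v`). The entries are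
then holomorphic germs, since `F i` is holomorphic at `0` and `F i 0 = 0`. -/
def abelianRelations (W : PlanarWeb d) :
    Submodule ℂ (Fin d → Germ (𝓝 (0 : ℂ × ℂ)) ℂ) where
  carrier := {h | ∃ g : Fin d → ℂ → ℂ,
    (∀ i, AnalyticAt ℂ (g i) 0) ∧
    (∀ i, h i = ((fun z => g i (W.F i z) : ℂ × ℂ → ℂ) : Germ (𝓝 (0 : ℂ × ℂ)) ℂ)) ∧
    ∀ᶠ z in 𝓝 (0 : ℂ × ℂ), ∀ v : ℂ × ℂ, ∑ i, g i (W.F i z) * fderiv ℂ (W.F i) z v = 0}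
  zero_mem' := ⟨fun _ _ => 0, fun _ => analyticAt_const, fun _ => rfl, by simp⟩
  add_mem' := by
    rintro a b ⟨g, hg, ha, hgs⟩ ⟨k, hk, hb, hks⟩
    refine ⟨fun i t => g i t + k i t, fun i => (hg i).add (hk i), fun i => ?_, ?_⟩
    · rw [Pi.add_apply, ha i, hb i]
      rfl
    · filter_upwards [hgs, hks] with z h1 h2 v
      simp only [add_mul, Finset.sum_add_distrib, h1 v, h2 v, add_zero]
  smul_mem' := by
    rintro c a ⟨g, hg, ha, hgs⟩
    refine ⟨fun i t => c * g i t, fun i => analyticAt_const.mul (hg i), fun i => ?_, ?_⟩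
    · rw [Pi.smul_apply, ha i]
      rfl
    · filter_upwards [hgs] with z h1 v
      simp only [mul_assoc, ← Finset.mul_sum, h1 v, mul_zero]

/-- The rank of a web: the complex dimension of its space of abelian relations. -/
noncomputable def rank (W : PlanarWeb d) : ℕ :=
  Module.finrank ℂ W.abelianRelations

/-- The web extracted from `W` by keeping the foliations with indices in the range of `s`. -/
def extract {k : ℕ} (W : PlanarWeb d) (s : Fin k ↪o Fin d) : PlanarWeb k where
  F i := W.F (s i)
  analyticAt i := W.analyticAt (s i)
  map_zero i := W.map_zero (s i)
  generalPosition i j hij := W.generalPosition (s i) (s j) (s.strictMono hij)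

/-- A web is hexagonal if all its extracted `3`-webs have rank `1`. -/
def IsHexagonal (W : PlanarWeb d) : Prop :=
  ∀ s : Fin 3 ↪o Fin d, (W.extract s).rank = 1

end PlanarWeb

/-! Upper bound: the lowest-order part of an abelian relation is `∑ c i ℓ i ^ n ℓ i = 0`, with `ℓ i`
the differentials at the origin, pairwise independent. Such relations form a space of dimension 2
for `n = 0`, 1 for `n = 1` and 0 beyond, so the rank is at most 2 + 1 = 3.

Lower bound: let `a` and `b` be the relations of the 3-webs omitting `F 3` and `F 2`. If the rank
were below 3, dependence of `a`, `b` and the relation omitting `F j` would give `b j = r j * a j`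
for `j = 0, 1`. With primitives, `A 0 + A 1 + A 2 = 0` and `r A 0 + s A 1 + B = 0`. In `B ^ 2 - r s
A 2 ^ 2` the cross terms `A 0 A 1` cancel, so the squares satisfy a linear relation. Its
differential is a relation vanishing at the origin, independent of `a` and `b`: a contradiction. -/

namespace PlanarWeb
variable {d : ℕ}

/-- A tuple of germs `g i` at the origin of `ℂ` with `∑ g i (F i) dF i = 0`. -/
structure IsAbelianRelation (W : PlanarWeb d) (g : Fin d → ℂ → ℂ) : Prop where
  analyticAt : ∀ i, AnalyticAt ℂ (g i) 0
  sum_eq_zero : ∀ᶠ z in 𝓝 (0 : ℂ × ℂ), ∀ v : ℂ × ℂ,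
    ∑ i, g i (W.F i z) * fderiv ℂ (W.F i) z v = 0

theorem IsAbelianRelation.sum_smul {W : PlanarWeb d} {ι : Type*} [Fintype ι]
    {g : ι → Fin d → ℂ → ℂ} (hg : ∀ k, W.IsAbelianRelation (g k)) (c : ι → ℂ) :
    W.IsAbelianRelation (fun i t => ∑ k, c k * g k i t) where
  analyticAt i := Finset.univ.analyticAt_fun_sum
    fun k _ => analyticAt_const.mul ((hg k).analyticAt i)
  sum_eq_zero := by
    filter_upwards [eventually_all.2 fun k => (hg k).sum_eq_zero] with z hz v
    simp only [Finset.sum_mul]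
    rw [Finset.sum_comm]
    refine Finset.sum_eq_zero fun k _ => ?_
    simp only [mul_assoc]
    rw [← Finset.mul_sum, hz k v, mul_zero]

/-! ### Leading forms of abelian relations -/

theorem tendsto_F (W : PlanarWeb d) (i : Fin d) : Tendsto (W.F i) (𝓝 0) (𝓝 0) := by
  simpa only [W.map_zero i] using (W.analyticAt i).continuousAt.tendsto

/-- A tangent vector at the origin annihilated by `dF i` only. -/
theorem exists_fderiv_eq_zero (W : PlanarWeb d) (i : Fin d) :
    ∃ v, fderiv ℂ (W.F i) 0 v = 0 ∧ ∀ j, j ≠ i → fderiv ℂ (W.F j) 0 v ≠ 0 := by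
  have key : ∀ j, fderiv ℂ (W.F j) 0 (fderiv ℂ (W.F i) 0 (0, 1), -fderiv ℂ (W.F i) 0 (1, 0)) =
      wedgeD (W.F j) (W.F i) 0 := by
    intro j
    have : (fderiv ℂ (W.F i) 0 (0, 1), -fderiv ℂ (W.F i) 0 (1, 0)) =
        fderiv ℂ (W.F i) 0 (0, 1) • ((1, 0) : ℂ × ℂ) -
          fderiv ℂ (W.F i) 0 (1, 0) • ((0, 1) : ℂ × ℂ) := by
      ext <;> simp
    rw [this, map_sub, map_smul, map_smul, wedgeD]
    simp only [smul_eq_mul]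
    ring
  refine ⟨_, (key i).trans (by rw [wedgeD]; ring), fun j hj => ?_⟩
  rw [key]
  rcases lt_or_gt_of_ne hj with h | h
  · exact W.generalPosition j i h
  · intro h0
    refine W.generalPosition i j h ?_
    rw [wedgeD] at h0 ⊢
    linear_combination -h0

/-- The homogeneous part of lowest degree of an abelian relation. -/
theorem sum_leading_eq_zero (W : PlanarWeb d) {k : Fin d → ℂ → ℂ}
    (hk : ∀ i, ContinuousAt (k i) 0) (n : ℕ)
    (h : ∀ᶠ z in 𝓝 (0 : ℂ × ℂ), ∀ v : ℂ × ℂ,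
      ∑ i, W.F i z ^ n * k i (W.F i z) * fderiv ℂ (W.F i) z v = 0) (v w : ℂ × ℂ) :
    ∑ i, fderiv ℂ (W.F i) 0 v ^ n * k i 0 * fderiv ℂ (W.F i) 0 w = 0 := by
  have hline : Tendsto (fun t : ℂ => t • v) (𝓝[≠] 0) (𝓝 0) := by
    have : Tendsto (fun t : ℂ => t • v) (𝓝 0) (𝓝 ((0 : ℂ) • v)) :=
      (continuous_id.smul continuous_const).tendsto _
    rw [zero_smul] at this
    exact this.mono_left nhdsWithin_le_nhds
  have hlim : Tendsto (fun t : ℂ => ∑ i, (t⁻¹ * W.F i (t • v)) ^ n * k i (W.F i (t • v)) *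
      fderiv ℂ (W.F i) (t • v) w) (𝓝[≠] 0)
      (𝓝 (∑ i, fderiv ℂ (W.F i) 0 v ^ n * k i 0 * fderiv ℂ (W.F i) 0 w)) := by
    refine tendsto_finsetSum _ fun i _ => (Tendsto.mul (Tendsto.pow ?_ n) ?_).mul ?_
    · have hd : HasFDerivAt (W.F i) (fderiv ℂ (W.F i) 0) ((0 : ℂ) • v) := by
        rw [zero_smul]; exact (W.analyticAt i).differentiableAt.hasFDerivAt
      have h1 : HasDerivAt (fun t : ℂ => W.F i (t • v)) (fderiv ℂ (W.F i) 0 v) 0 := by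
        have h2 : HasDerivAt (fun t : ℂ => t • v) v 0 := by
          simpa using (hasDerivAt_id (0 : ℂ)).smul_const v
        exact hd.comp_hasDerivAt (0 : ℂ) h2
      simpa [slope_fun_def, W.map_zero i] using h1.tendsto_slope
    · exact (hk i).tendsto.comp ((W.tendsto_F i).comp hline)
    · have hc : ContinuousAt (fun z => fderiv ℂ (W.F i) z w) 0 :=
        (W.analyticAt i).fderiv.continuousAt.clm_apply continuousAt_const
      exact hc.tendsto.comp hline
  -- The limit is that of the relation at `t • v` divided by `t ^ n`, which is zero throughout.
  refine tendsto_nhds_unique hlim (tendsto_const_nhds.congr' ?_)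
  filter_upwards [hline.eventually h] with t ht
  have := congrArg (fun x => (t⁻¹) ^ n * x) (ht w)
  simp only [mul_zero, Finset.mul_sum] at this
  rw [← this]
  refine Finset.sum_congr rfl fun i _ => ?_
  rw [mul_pow]
  ring

/-- Polarization of a vanishing combination of powers of linear forms. -/
theorem sum_pow_mul_eq_zero {ι E : Type*} [Fintype ι] [NormedAddCommGroup E] [NormedSpace ℂ E]
    (l : ι → E →L[ℂ] ℂ) (e : ι → ℂ) (m : ℕ) (h : ∀ v, ∑ i, e i * l i v ^ (m + 1) = 0)
    (v w : E) : ∑ i, e i * l i w * l i v ^ m = 0 := by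
  have h1 : HasDerivAt (fun t : ℂ => ∑ i, e i * l i (v + t • w) ^ (m + 1))
      (∑ i, e i * ((m + 1 : ℕ) * l i v ^ m * l i w)) 0 := by
    refine HasDerivAt.fun_sum fun i _ => HasDerivAt.const_mul _ ?_
    have h2 : HasDerivAt (fun t : ℂ => l i (v + t • w)) (l i w) 0 := by
      simpa using ((hasDerivAt_id (0 : ℂ)).mul_const (l i w)).const_add (l i v)
    simpa using h2.fun_pow (m + 1)
  simp only [h] at h1
  have h3 := h1.unique (hasDerivAt_const _ _)
  have h4 : ((m + 1 : ℕ) : ℂ) ≠ 0 := Nat.cast_ne_zero.2 m.succ_ne_zero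
  refine (mul_eq_zero.1 ?_).resolve_left h4
  rw [← h3, Finset.mul_sum]
  exact Finset.sum_congr rfl fun i _ => by ring

theorem exists_univ_eq_insert (i p : Fin 4) (h : i ≠ p) : ∃ j k : Fin 4,
    i ≠ j ∧ i ≠ k ∧ p ≠ j ∧ p ≠ k ∧ j ≠ k ∧ (Finset.univ : Finset (Fin 4)) = {i, p, j, k} := by
  revert i p
  decide

theorem exists_univ_eq_insert_insert (i p q : Fin 4) (hip : i ≠ p) (hiq : i ≠ q) (hpq : p ≠ q) :
    ∃ j : Fin 4, i ≠ j ∧ p ≠ j ∧ q ≠ j ∧ (Finset.univ : Finset (Fin 4)) = {i, p, q, j} := by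
  obtain ⟨j, k, hij, hik, hpj, hpk, hjk, h⟩ := exists_univ_eq_insert i p hip
  have hq : q ∈ ({i, p, j, k} : Finset (Fin 4)) := h ▸ Finset.mem_univ q
  simp only [Finset.mem_insert, Finset.mem_singleton, hiq.symm, hpq.symm, false_or] at hq
  rcases hq with rfl | rfl
  · exact ⟨k, hik, hpk, hjk, h⟩
  · exact ⟨j, hij, hpj, hjk.symm, by rw [h, Finset.pair_comm]⟩

/-- A relation `∑ c i ℓ i ^ n ℓ i = 0` between the differentials `ℓ i` of a `4`-web at the origin
is trivial if `n` is at least two, or if `2 - n` of its coefficients vanish. -/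
theorem leading_coeff_eq_zero (W : PlanarWeb 4) (c : Fin 4 → ℂ) (n : ℕ)
    (h : ∀ v w, ∑ i, fderiv ℂ (W.F i) 0 v ^ n * c i * fderiv ℂ (W.F i) 0 w = 0)
    {p q : Fin 4} (hpq : p ≠ q) (hp : n ≤ 1 → c p = 0) (hq : n = 0 → c q = 0) (i : Fin 4) :
    c i = 0 := by
  choose u hu0 hu using W.exists_fderiv_eq_zero
  rcases n with _ | _ | n
  · by_contra hi
    have hip : i ≠ p := by rintro rfl; exact hi (hp (by norm_num))
    have hiq : i ≠ q := by rintro rfl; exact hi (hq rfl)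
    obtain ⟨j, hij, hpj, hqj, huniv⟩ := exists_univ_eq_insert_insert i p q hip hiq hpq
    have := h 0 (u j)
    rw [huniv, Finset.sum_insert (by simp [*]), Finset.sum_insert (by simp [*]),
      Finset.sum_insert (by simp [*]), Finset.sum_singleton, hp (by norm_num), hq rfl, hu0 j]
      at this
    simp only [pow_zero, one_mul, zero_mul, mul_zero, add_zero] at this
    exact (mul_eq_zero.1 this).elim hi (hu j i hij)
  · by_contra hi
    have hip : i ≠ p := by rintro rfl; exact hi (hp (by norm_num))
    obtain ⟨j, k, hij, hik, hpj, hpk, hjk, huniv⟩ := exists_univ_eq_insert i p hip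
    have := h (u j) (u k)
    rw [huniv, Finset.sum_insert (by simp [*]), Finset.sum_insert (by simp [*]),
      Finset.sum_insert (by simp [*]), Finset.sum_singleton, hp (by norm_num), hu0 j, hu0 k]
      at this
    have hj := hu j i hij
    have hk := hu k i hik
    simp_all
  -- From degree three on there are enough slots to isolate `i`: the vectors `u l`, `u j`, `u k`
  -- each kill one of the other three forms.
  · obtain ⟨l, hil⟩ := exists_ne i
    obtain ⟨j, k, hij, hik, hlj, hlk, hjk, huniv⟩ := exists_univ_eq_insert i l hil.symm
    have h2 := sum_pow_mul_eq_zero (fun i => fderiv ℂ (W.F i) 0)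
      (fun i => c i * fderiv ℂ (W.F i) 0 (u l)) (n + 1)
      (fun v => by rw [← h v (u l)]; exact Finset.sum_congr rfl fun i _ => by ring) (u j) (u k)
    have hl' := hu l i hil.symm
    have hj := hu j i hij
    have hk := hu k i hik
    have hil' := hil.symm
    rw [huniv, Finset.sum_insert (by simp [*]), Finset.sum_insert (by simp [*]),
      Finset.sum_insert (by simp [*]), Finset.sum_singleton, hu0 l, hu0 j, hu0 k] at h2
    simp_all

/-- An abelian relation of a `4`-web is determined by the values at the origin of two of its
components and by the derivative of one of these. -/
theorem IsAbelianRelation.eventually_eq_zero {W : PlanarWeb 4} {g : Fin 4 → ℂ → ℂ}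
    (hg : W.IsAbelianRelation g) {p q : Fin 4} (hpq : p ≠ q) (hp : g p 0 = 0) (hq : g q 0 = 0)
    (hp' : deriv (g p) 0 = 0) (i : Fin 4) : ∀ᶠ t in 𝓝 0, g i t = 0 := by
  -- All components vanish to every order: if they vanish to order `n`, the order-`n` coefficients
  -- `k i 0` satisfy the leading relation. The hypotheses at `p` and `q` supply the vanishing
  -- coefficients needed when `n` is 0 or 1.
  have key : ∀ n : ℕ, ∀ i, (n : ℕ∞) ≤ analyticOrderAt (g i) 0 := by
    intro n
    induction n with
    | zero => simp
    | succ n ih =>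
      choose k hk hgk using fun i => (natCast_le_analyticOrderAt (hg.analyticAt i)).1 (ih i)
      simp only [sub_zero, smul_eq_mul] at hgk
      have hsum := W.sum_leading_eq_zero (fun i => (hk i).continuousAt) n (by
        filter_upwards [hg.sum_eq_zero, eventually_all.2 fun i => (W.tendsto_F i).eventually (hgk i)]
          with z hz hz' v
        rw [← hz v]
        exact Finset.sum_congr rfl fun i _ => by rw [hz' i])
      have hk0 : ∀ i, k i 0 = 0 := by
        refine W.leading_coeff_eq_zero (fun i => k i 0) n hsum hpq ?_ ?_
        · intro hn
          rcases n with _ | _ | n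
          · simpa [hp] using (hgk p).self_of_nhds.symm
          · have h1 : HasDerivAt (fun t => t * k p t) (k p 0) 0 := by
              simpa using (hasDerivAt_id (0 : ℂ)).fun_mul (hk p).differentiableAt.hasDerivAt
            have h2 : g p =ᶠ[𝓝 0] fun t => t * k p t := by
              filter_upwards [hgk p] with t ht
              simpa using ht
            exact (h1.deriv.symm.trans h2.deriv_eq.symm).trans hp'
          · omega
        · rintro rfl
          simpa [hq] using (hgk q).self_of_nhds.symm
      intro i
      obtain ⟨r, hr, hkr⟩ := (natCast_le_analyticOrderAt (n := 1) (hk i)).1 (by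
        simpa [Order.one_le_iff_ne_zero] using (hk i).analyticOrderAt_ne_zero.2 (hk0 i))
      refine (natCast_le_analyticOrderAt (hg.analyticAt i)).2 ⟨r, hr, ?_⟩
      filter_upwards [hgk i, hkr] with t h1 h2
      rw [h1, h2]
      simp only [sub_zero, smul_eq_mul]
      ring
  exact analyticOrderAt_eq_top.1 (ENat.eq_top_iff_forall_ge.2 fun n => key n i)

/-! ### Bounding the dimension, and linear dependence of relations -/

theorem sum_smul_apply {W : PlanarWeb d} {ι : Type*} [Fintype ι] {m : ι → W.abelianRelations}
    {g : ι → Fin d → ℂ → ℂ}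
    (hm : ∀ k i, (m k).1 i = ((fun z => g k i (W.F i z) : ℂ × ℂ → ℂ) : Germ (𝓝 (0 : ℂ × ℂ)) ℂ))
    (c : ι → ℂ) (i : Fin d) : (∑ k, c k • m k).1 i =
      ((fun z => ∑ k, c k * g k i (W.F i z) : ℂ × ℂ → ℂ) : Germ (𝓝 (0 : ℂ × ℂ)) ℂ) := by
  have h := map_sum (Germ.coeRingHom (𝓝 (0 : ℂ × ℂ)) (R := ℂ))
    (fun k (z : ℂ × ℂ) => c k * g k i (W.F i z)) Finset.univ
  simp only [Germ.coe_coeRingHom] at h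
  rw [show (fun z : ℂ × ℂ => ∑ k, c k * g k i (W.F i z)) = ∑ k, fun z : ℂ × ℂ => c k * g k i (W.F i z) by
    ext z; simp, h, Submodule.coe_sum, Finset.sum_apply]
  refine Finset.sum_congr rfl fun k _ => ?_
  rw [Submodule.coe_smul, Pi.smul_apply, hm]
  rfl

theorem rank_abelianRelations_le (W : PlanarWeb 4) : Module.rank ℂ W.abelianRelations ≤ 3 := by
  have hex : ∀ m : W.abelianRelations, ∃ g : Fin 4 → ℂ → ℂ, W.IsAbelianRelation g ∧
      ∀ i, m.1 i = ((fun z => g i (W.F i z) : ℂ × ℂ → ℂ) : Germ (𝓝 (0 : ℂ × ℂ)) ℂ) := by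
    rintro ⟨m, g, h1, h2, h3⟩
    exact ⟨g, ⟨h1, h3⟩, h2⟩
  choose g hg hm using hex
  refine rank_le fun s hs => ?_
  by_contra hcard
  -- The rows are the three functionals that determine a relation; on more than three relations they
  -- have a common kernel vector.
  let M : Matrix (Fin 3) s ℂ := ![fun m => g m 0 0, fun m => g m 1 0, fun m => deriv (g m 0) 0]
  have hker := M.mulVecLin.ker_ne_bot_of_finrank_lt (by simpa using hcard)
  obtain ⟨c, hc, hc0⟩ := (Submodule.ne_bot_iff _).1 hker
  replace hc : M.mulVec c = 0 := hc
  have e0 := congrFun hc 0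
  have e1 := congrFun hc 1
  have e2 := congrFun hc 2
  simp only [Matrix.mulVec, dotProduct, M, Matrix.cons_val, Pi.zero_apply, mul_comm _ (c _)]
    at e0 e1 e2
  have hd : deriv (fun t => ∑ k : s, c k * g (k : W.abelianRelations) 0 t) 0 = 0 := by
    have hdiff (k : s) : DifferentiableAt ℂ (g (k : W.abelianRelations) 0) 0 :=
      ((hg k).analyticAt 0).differentiableAt
    rw [deriv_fun_sum fun k _ => (hdiff k).const_mul (c k)]
    refine Eq.trans ?_ e2
    exact Finset.sum_congr rfl fun k _ => deriv_const_mul _ (hdiff k)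
  have hz := (IsAbelianRelation.sum_smul (fun k : s => hg (k : W.abelianRelations)) c).eventually_eq_zero
    (p := 0) (q := 1) (by decide) e0 e1 hd
  refine hc0 (funext fun k => ?_)
  refine Fintype.linearIndependent_iff.1 hs c ?_ k
  refine Subtype.ext (funext fun i => ?_)
  have h1 : (fun z => ∑ k : s, c k * g (k : W.abelianRelations) i (W.F i z)) =ᶠ[𝓝 0] fun _ => (0 : ℂ) :=
    (W.tendsto_F i).eventually (hz i)
  rw [sum_smul_apply (fun k : s => hm (k : W.abelianRelations))]
  exact Germ.coe_eq.2 h1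

/-- `F i` is a submersion, hence open at the origin. This lets an identity of germs in `F i` descend
to one in the single variable `t`. -/
theorem map_F_nhds (W : PlanarWeb 4) (i : Fin 4) : map (W.F i) (𝓝 0) = 𝓝 0 := by
  obtain ⟨j, hj⟩ := exists_ne i
  obtain ⟨v, -, hv⟩ := W.exists_fderiv_eq_zero j
  have h := (W.analyticAt i).hasStrictFDerivAt.map_nhds_eq_of_surj
    (LinearMap.range_eq_top.2 (LinearMap.surjective (f := (fderiv ℂ (W.F i) 0).toLinearMap)
      fun h0 => hv i hj.symm (LinearMap.congr_fun h0 v)))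
  rwa [W.map_zero i] at h

/-- Three abelian relations of a `4`-web of rank less than three are linearly dependent. -/
theorem exists_sum_eq_zero_of_finrank_lt {W : PlanarWeb 4} (hW : W.rank < 3)
    {g : Fin 3 → Fin 4 → ℂ → ℂ} (hg : ∀ k, W.IsAbelianRelation (g k)) :
    ∃ c : Fin 3 → ℂ, c ≠ 0 ∧ ∀ i, ∀ᶠ t in 𝓝 0,
      c 0 * g 0 i t + c 1 * g 1 i t + c 2 * g 2 i t = 0 := by
  -- Needed because `finrank` would be 0, hence below 3, in infinite dimension.
  have : Module.Finite ℂ W.abelianRelations :=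
    Module.rank_lt_aleph0_iff.1 (W.rank_abelianRelations_le.trans_lt Cardinal.ofNat_lt_aleph0)
  let m : Fin 3 → W.abelianRelations := fun k =>
    ⟨fun i => ((fun z => g k i (W.F i z) : ℂ × ℂ → ℂ) : Germ (𝓝 (0 : ℂ × ℂ)) ℂ), g k,
      (hg k).analyticAt, fun _ => rfl, (hg k).sum_eq_zero⟩
  have hm : ¬ LinearIndependent ℂ m := fun h => by
    have := h.fintype_card_le_finrank
    rw [Fintype.card_fin] at this
    exact absurd hW (not_lt.2 this)
  obtain ⟨c, hc, k, hk⟩ := Fintype.not_linearIndependent_iff.1 hm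
  refine ⟨c, fun h => hk (congrFun h k), fun i => ?_⟩
  rw [← W.map_F_nhds i, eventually_map]
  have h1 := sum_smul_apply (m := m) (g := g) (fun _ _ => rfl) c i
  rw [hc] at h1
  filter_upwards [Germ.coe_eq.1 h1.symm] with z hz
  simpa [Fin.sum_univ_three] using hz

/-- Each extracted `3`-web of a hexagonal `4`-web has an abelian relation whose components do not
vanish at the origin. -/
theorem IsHexagonal.exists_isAbelianRelation {W : PlanarWeb 4} (hW : W.IsHexagonal) (l : Fin 4) :
    ∃ g, W.IsAbelianRelation g ∧ g l = 0 ∧ ∀ i, i ≠ l → g i 0 ≠ 0 := by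
  have hpos : 0 < Module.finrank ℂ (W.extract (Fin.succAboveOrderEmb l)).abelianRelations := by
    have := hW (Fin.succAboveOrderEmb l)
    rw [rank] at this
    omega
  have := Module.nontrivial_of_finrank_pos hpos
  obtain ⟨⟨m, g, hg, hm, hsum⟩, hne⟩ :=
    exists_ne (0 : (W.extract (Fin.succAboveOrderEmb l)).abelianRelations)
  have hrel : W.IsAbelianRelation (l.insertNth 0 g) := by
    constructor
    · intro i
      refine l.succAboveCases ?_ (fun j => ?_) i
      · rw [Fin.insertNth_apply_same]; exact analyticAt_const
      · rw [Fin.insertNth_apply_succAbove]; exact hg j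
    · filter_upwards [hsum] with z hz v
      rw [Fin.sum_univ_succAbove _ l]
      simp only [Fin.insertNth_apply_same, Fin.insertNth_apply_succAbove, Pi.zero_apply, zero_mul,
        zero_add]
      exact hz v
  refine ⟨l.insertNth 0 g, hrel, Fin.insertNth_apply_same .., fun i hi h0 => hne ?_⟩
  -- The zero component `l` supplies both the value and the derivative, so one further zero at the
  -- origin kills the relation.
  have hz := hrel.eventually_eq_zero (p := l) (q := i) hi.symm (by simp) h0 (by
    rw [Fin.insertNth_apply_same]; exact deriv_const 0 0)
  refine Subtype.ext (funext fun j => (hm j).trans (Germ.coe_eq.2 ?_))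
  have := hz (l.succAbove j)
  rw [Fin.insertNth_apply_succAbove] at this
  exact (W.tendsto_F (l.succAbove j)).eventually this

/-! ### Primitives and the quadratic relation -/

theorem exists_primitive {g : ℂ → ℂ} (hg : AnalyticAt ℂ g 0) :
    ∃ f : ℂ → ℂ, AnalyticAt ℂ f 0 ∧ f 0 = 0 ∧ ∀ᶠ t in 𝓝 0, HasDerivAt f (g t) t := by
  obtain ⟨r, hr, hgr⟩ := Metric.eventually_nhds_iff_ball.1 hg.eventually_analyticAt
  obtain ⟨f, hf⟩ := DifferentiableOn.isExactOn_ball (c := (0 : ℂ)) (r := r)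
    (fun t ht => (hgr t ht).differentiableAt.differentiableWithinAt)
  have hball : Metric.ball (0 : ℂ) r ∈ 𝓝 0 := Metric.ball_mem_nhds 0 hr
  refine ⟨fun t => f t - f 0, ?_, sub_self _, ?_⟩
  · refine AnalyticAt.sub (DifferentiableOn.analyticAt (s := Metric.ball 0 r) ?_ hball)
      analyticAt_const
    exact fun t ht => (hf t ht).differentiableAt.differentiableWithinAt
  · filter_upwards [hball] with t ht
    exact (hf t ht).sub_const _

theorem eventually_eq_zero_of_fderiv {E : Type*} [NormedAddCommGroup E] [NormedSpace ℂ E]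
    {f : E → ℂ} {f' : E → E →L[ℂ] ℂ} (h0 : f 0 = 0)
    (hf : ∀ᶠ z in 𝓝 0, HasFDerivAt f (f' z) z) (hf' : ∀ᶠ z in 𝓝 0, f' z = 0) :
    ∀ᶠ z in 𝓝 0, f z = 0 := by
  obtain ⟨r, hr, h⟩ := Metric.eventually_nhds_iff_ball.1 (hf.and hf')
  filter_upwards [Metric.ball_mem_nhds 0 hr] with z hz
  have := (Metric.isOpen_ball (x := (0 : E)) (ε := r)).is_const_of_fderiv_eq_zero (𝕜 := ℂ)
    (convex_ball (0 : E) r).isPreconnected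
    (fun x hx => (h x hx).1.differentiableAt.differentiableWithinAt)
    (fun x hx => (h x hx).1.fderiv.trans (h x hx).2) hz (Metric.mem_ball_self hr)
  rw [this, h0]

/-- A linear relation between primitives of the components of an abelian relation. -/
theorem IsAbelianRelation.sum_primitive_eq_zero {W : PlanarWeb d} {g f : Fin d → ℂ → ℂ}
    (hg : W.IsAbelianRelation g) (h0 : ∀ i, f i 0 = 0)
    (hf : ∀ i, ∀ᶠ t in 𝓝 0, HasDerivAt (f i) (g i t) t) :
    ∀ᶠ z in 𝓝 0, ∑ i, f i (W.F i z) = 0 := by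
  refine eventually_eq_zero_of_fderiv (f' := fun z => ∑ i, g i (W.F i z) • fderiv ℂ (W.F i) z)
    (by simp [W.map_zero, h0]) ?_ ?_
  · filter_upwards [eventually_all.2 fun i => (W.tendsto_F i).eventually (hf i),
      eventually_all.2 fun i => (W.analyticAt i).eventually_analyticAt] with z hz hF
    exact HasFDerivAt.fun_sum fun i _ =>
      (hz i).comp_hasFDerivAt z (hF i).differentiableAt.hasFDerivAt
  · filter_upwards [hg.sum_eq_zero] with z hz
    refine ContinuousLinearMap.ext fun v => ?_
    simpa using hz v

theorem IsHexagonal.not_rank_lt_three {W : PlanarWeb 4} (hW : W.IsHexagonal) : ¬ W.rank < 3 := by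
  intro hlt
  obtain ⟨a, ha, ha3, ha0⟩ := hW.exists_isAbelianRelation 3
  obtain ⟨b, hb, hb2, hb0⟩ := hW.exists_isAbelianRelation 2
  have hprop : ∀ j k : Fin 4, j ≠ 2 → j ≠ 3 → k ≠ 2 → k ≠ 3 → j ≠ k →
      ∃ r : ℂ, ∀ᶠ t in 𝓝 0, b j t = r * a j t := by
    intro j k hj2 hj3 hk2 hk3 hjk
    obtain ⟨e, he, hej, he0⟩ := hW.exists_isAbelianRelation j
    obtain ⟨c, hc, hrel⟩ := exists_sum_eq_zero_of_finrank_lt (g := ![a, b, e]) hlt (by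
      intro i; fin_cases i <;> assumption)
    simp only [Matrix.cons_val] at hrel
    -- If `c 1 = 0`, component 3, where `a` is zero, forces `c 2 = 0`; component 2 then forces `c 0
    -- = 0`.
    have h1 : c 1 ≠ 0 := by
      intro h1
      have e3 := (hrel 3).self_of_nhds
      have e2 := (hrel 2).self_of_nhds
      have hb3 := hb0 3 (by decide)
      have ha2 := ha0 2 (by decide)
      have he3 := he0 3 hj3.symm
      have hc2 : c 2 = 0 := by simpa [ha3, h1, he3] using e3
      have hc0 : c 0 = 0 := by simpa [hb2, h1, hc2, ha2] using e2
      exact hc (by ext i; fin_cases i <;> assumption)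
    refine ⟨-c 0 / c 1, ?_⟩
    filter_upwards [hrel j] with t ht
    rw [hej, Pi.zero_apply] at ht
    field_simp
    linear_combination ht
  obtain ⟨r, hr⟩ := hprop 0 1 (by decide) (by decide) (by decide) (by decide) (by decide)
  obtain ⟨s, hs⟩ := hprop 1 0 (by decide) (by decide) (by decide) (by decide) (by decide)
  choose A hA hA0 hAd using fun i => exists_primitive (ha.analyticAt i)
  obtain ⟨B, hB, hB0, hBd⟩ := exists_primitive (hb.analyticAt 3)
  have hsumA := ha.sum_primitive_eq_zero (f := ![A 0, A 1, A 2, 0])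
    (by intro i; fin_cases i <;> simp [hA0]) (by
      intro i
      fin_cases i
      · exact hAd 0
      · exact hAd 1
      · exact hAd 2
      · exact Eventually.of_forall fun t => by simp [ha3])
  have hsumB := hb.sum_primitive_eq_zero
    (f := ![fun t => r * A 0 t, fun t => s * A 1 t, 0, B])
    (by intro i; fin_cases i <;> simp [hA0, hB0]) (by
      intro i
      fin_cases i
      · filter_upwards [hr, hAd 0] with t h1 h2
        simpa [h1] using h2.const_mul r
      · filter_upwards [hs, hAd 1] with t h1 h2
        simpa [h1] using h2.const_mul s
      · exact Eventually.of_forall fun t => by simp [hb2]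
      · exact hBd)
  -- Half the differential of `(r s - r ^ 2) A 0 ^ 2 + (r s - s ^ 2) A 1 ^ 2 - r s A 2 ^ 2 + B ^ 2 =
  -- 0`.
  have hquad : W.IsAbelianRelation
      ![fun t => (r * s - r ^ 2) * (A 0 t * a 0 t), fun t => (r * s - s ^ 2) * (A 1 t * a 1 t),
        fun t => -(r * s) * (A 2 t * a 2 t), fun t => B t * b 3 t] := by
    constructor
    · intro i
      fin_cases i
      · exact analyticAt_const.mul ((hA 0).mul (ha.analyticAt 0))
      · exact analyticAt_const.mul ((hA 1).mul (ha.analyticAt 1))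
      · exact analyticAt_const.mul ((hA 2).mul (ha.analyticAt 2))
      · exact hB.mul (hb.analyticAt 3)
    · filter_upwards [ha.sum_eq_zero, hb.sum_eq_zero, hsumA, hsumB,
        (W.tendsto_F 0).eventually hr, (W.tendsto_F 1).eventually hs] with z h1 h2 h3 h4 h5 h6 v
      specialize h1 v
      specialize h2 v
      simp only [Fin.sum_univ_four, Matrix.cons_val, ha3, hb2, Pi.zero_apply, zero_mul, add_zero,
        h5, h6] at h1 h2 h3 h4 ⊢
      have e2 := eq_neg_of_add_eq_zero_right h3
      have e3 := eq_neg_of_add_eq_zero_right h4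
      have f2 := eq_neg_of_add_eq_zero_right h1
      have f3 := eq_neg_of_add_eq_zero_right h2
      simp only [mul_assoc] at f2 f3 ⊢
      rw [e2, e3, f2, f3]
      ring
  obtain ⟨c, hc, hrel⟩ := exists_sum_eq_zero_of_finrank_lt hlt
    (g := ![a, b, ![fun t => (r * s - r ^ 2) * (A 0 t * a 0 t),
      fun t => (r * s - s ^ 2) * (A 1 t * a 1 t),
      fun t => -(r * s) * (A 2 t * a 2 t), fun t => B t * b 3 t]]) (by
      intro i; fin_cases i <;> assumption)
  have ha2 := ha0 2 (by decide)
  have hb3 := hb0 3 (by decide)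
  have hc0 : c 0 = 0 := by
    simpa [hb2, hA0, ha2] using (hrel 2).self_of_nhds
  have hc1 : c 1 = 0 := by
    simpa [ha3, hB0, hb3] using (hrel 3).self_of_nhds
  have hc2 : c 2 = 0 := by
    -- `B * b 3` vanishes at the origin but, since `B' = b 3`, its derivative there is `b 3 0 ^ 2 ≠
    -- 0`.
    have h1 : HasDerivAt (fun t => c 2 * (B t * b 3 t)) (c 2 * (b 3 0 * b 3 0)) 0 := by
      have := (hBd.self_of_nhds.fun_mul
        (hb.analyticAt 3).differentiableAt.hasDerivAt).const_mul (c 2)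
      simpa [hB0] using this
    have h2 : (fun t => c 2 * (B t * b 3 t)) =ᶠ[𝓝 0] fun _ => 0 := by
      filter_upwards [hrel 3] with t ht
      simpa [hc0, hc1] using ht
    have h3 := h1.deriv.symm.trans (h2.deriv_eq.trans (deriv_const 0 0))
    simpa [hb3] using h3
  exact hc (by ext i; fin_cases i <;> assumption)

end PlanarWeb

theorem proposition4 (W : PlanarWeb 4) (hW : W.IsHexagonal) : W.rank = 3 :=
  le_antisymm (Module.finrank_le_of_rank_le W.rank_abelianRelations_le)
    (not_lt.1 hW.not_rank_lt_three)
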